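/- Let $d, t \in \mathbb{N}$, let $\nu$ be an ensemble of $d \times d$ unitaries, i.e. a Borel probability measure on the unitary group $\mathrm{U}(d)$, and let $\mu_H$ be the Haar probability measure on $\mathrm{U}(d)$. Suppose that $\nu$ is an exact (non-adaptive) unitary $t$-design, that is, for every linear operator $O$ on $(\mathbb{C}^d)^{\otimes t}$, $$\mathbb{E}_{U \sim \nu}\left[U^{\otimes t}\, O\, (U^{\otimes t})^\dagger\right] = \mathbb{E}_{U \sim \mu_H}\left[U^{\otimes t}\, O\, (U^{\otimes t})^\dagger\right].$$ Then $\nu$ is also an exact adaptive mixed unitary $t$-design, that is, for every quantum algorithm $\mathcal{A}$ with a single-bit output that has oracle access to $U$ and $U^\dagger$ and makes at most $t$ queries in total, $$\Pr\left[1 \leftarrow \mathcal{A}^{U, U^\dagger} : U \sim \nu\right] = \Pr\left[1 \leftarrow \mathcal{A}^{U, U^\dagger} : U \sim \mu_H\right].$$ Here $\mathcal{A}$ starts from an arbitrary density matrix on a $d$-dimensional query register together with a finite-dimensional memory register. It then performs finitely many operations, each of which is either a query, which applies $U$ or $U^\dagger$ to the query register, or an arbitrary oracle-independent quantum operation on both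 registers, possibly with finitely many classical measurement outcomes. All later operations, including whether to query and whether to query $U$ or $U^\dagger$, may depend on the earlier classical outcomes, and the number of queries is at most $t$ on every branch. Finally $\mathcal{A}$ performs a two-outcome measurement, whose result is its output. There is no restriction on the running time or memory size of $\mathcal{A}$, and queries are not coherently controlled. -/

import Mathlib

open MeasureTheory
open scoped Matrix Kronecker ComplexOrder

noncomputable section

namespace UnitaryDesign

/-- The unitary group `U(d)` of `d × d` complex matrices, with the topology of matrices. -/
abbrev U (d : ℕ) : Type := Matrix.unitaryGroup (Fin d) ℂ

instance instCompactSpaceU (d : ℕ) : CompactSpace (U d) := by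
  have hB : IsCompact (Set.pi Set.univ fun _ : Fin d => Set.pi Set.univ fun _ : Fin d =>
      Metric.closedBall (0 : ℂ) 1) :=
    isCompact_univ_pi fun _ => isCompact_univ_pi fun _ => isCompact_closedBall _ _
  have hC : IsClosed {A : Matrix (Fin d) (Fin d) ℂ | A * star A = 1} :=
    isClosed_eq (continuous_id.mul continuous_star) continuous_const
  have hK : IsCompact (Matrix.unitaryGroup (Fin d) ℂ : Set (Matrix (Fin d) (Fin d) ℂ)) := by
    have hsub : (Matrix.unitaryGroup (Fin d) ℂ : Set (Matrix (Fin d) (Fin d) ℂ)) =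
        (Set.pi Set.univ fun _ : Fin d => Set.pi Set.univ fun _ : Fin d =>
          Metric.closedBall (0 : ℂ) 1) ∩ {A : Matrix (Fin d) (Fin d) ℂ | A * star A = 1} := by
      ext A
      constructor
      · intro hA
        refine ⟨?_, Matrix.mem_unitaryGroup_iff.1 hA⟩
        intro i _ j _
        simpa using entry_norm_bound_of_unitary hA i j
      · intro hA
        exact Matrix.mem_unitaryGroup_iff.2 hA.2
    rw [hsub]
    exact hB.inter_right hC
  exact isCompact_iff_compactSpace.1 hK

/-- `U(d)` carries its Borel `σ`-algebra. -/
instance instMeasurableSpaceU (d : ℕ) : MeasurableSpace (U d) := borel (U d)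

instance instBorelSpaceU (d : ℕ) : BorelSpace (U d) := ⟨rfl⟩

/-- The Haar probability measure on `U(d)`. -/
def haarU (d : ℕ) : Measure (U d) := Measure.haarMeasure ⊤

instance instIsProbabilityMeasureHaarU (d : ℕ) : IsProbabilityMeasure (haarU d) :=
  ⟨Measure.haarMeasure_self⟩

/-! ### Non-adaptive designs -/

/-- The tensor power `A^{⊗ n}` on `(ℂ^d)^{⊗ n}`, in the product basis indexed by
`Fin n → Fin d`. -/
def tensorPower {d : ℕ} (n : ℕ) (A : Matrix (Fin d) (Fin d) ℂ) :
    Matrix (Fin n → Fin d) (Fin n → Fin d) ℂ :=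
  Matrix.of fun a b => ∏ k, A (a k) (b k)

/-- The expectation of a matrix-valued function of a random unitary, taken entrywise. -/
def matrixMean {d : ℕ} {ι : Type} (ν : Measure (U d)) (F : U d → Matrix ι ι ℂ) :
    Matrix ι ι ℂ :=
  Matrix.of fun i j => ∫ V, F V i j ∂ν

/-- `V^{⊗ p} ⊗ (V†)^{⊗ q}`. -/
def mixedPower {d : ℕ} (p q : ℕ) (V : U d) :
    Matrix ((Fin p → Fin d) × (Fin q → Fin d)) ((Fin p → Fin d) × (Fin q → Fin d)) ℂ :=
  tensorPower p (V : Matrix (Fin d) (Fin d) ℂ) ⊗ₖ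
    tensorPower q ((V : Matrix (Fin d) (Fin d) ℂ)ᴴ)

/-- Non-adaptive mixed unitary `(p, q)`-designs. -/
def IsMixedDesign {d : ℕ} (ν : Measure (U d)) (p q : ℕ) : Prop :=
  ∀ O : Matrix ((Fin p → Fin d) × (Fin q → Fin d)) ((Fin p → Fin d) × (Fin q → Fin d)) ℂ,
    matrixMean ν (fun V => mixedPower p q V * O * (mixedPower p q V)ᴴ) =
      matrixMean (haarU d) (fun V => mixedPower p q V * O * (mixedPower p q V)ᴴ)

/-- Non-adaptive unitary `t`-designs: `(t, 0)`-designs. -/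
def IsDesign {d : ℕ} (ν : Measure (U d)) (t : ℕ) : Prop :=
  IsMixedDesign ν t 0

/-! ### Adaptive query algorithms -/

/-- A program with oracle access to a unitary `V ∈ U(d)` and to its adjoint, acting on a query
register `ℂ^d` and a memory register `ℂ^w`.

* `output E`: measure `{E, 1 - E}` and output `1` on the outcome of `E`;
* `query next`: apply `V` to the query register and continue with `next`;
* `queryAdj next`: apply `V†` to the query register and continue with `next`;
* `step w' K next`: an arbitrary oracle-independent quantum operation with a classical outcome.
  Outcome `i` turns the state `ρ` into `K i * ρ * (K i)ᴴ` (unnormalised), the memory is then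
  `ℂ^(w' i)`, and the program continues with `next i`. Unitary gates, quantum channels,
  intermediate measurements and random choices are all of this form. -/
inductive Program (d : ℕ) : ℕ → Type
  | output {w : ℕ} (E : Matrix (Fin d × Fin w) (Fin d × Fin w) ℂ)
      (hE : E.PosSemidef) (hE' : (1 - E).PosSemidef) : Program d w
  | query {w : ℕ} (next : Program d w) : Program d w
  | queryAdj {w : ℕ} (next : Program d w) : Program d w
  | step {w m : ℕ} (w' : Fin m → ℕ)
      (K : (i : Fin m) → Matrix (Fin d × Fin (w' i)) (Fin d × Fin w) ℂ)
      (hK : ∑ i, (K i)ᴴ * K i = 1)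
      (next : (i : Fin m) → Program d (w' i)) : Program d w

namespace Program

/-- The number of queries, to the unitary and to its adjoint together, made along the worst
branch of the program. -/
def queries {d : ℕ} : {w : ℕ} → Program d w → ℕ
  | _, output _ _ _ => 0
  | _, query next => next.queries + 1
  | _, queryAdj next => next.queries + 1
  | _, step _ _ _ next => Finset.univ.sup fun i => (next i).queries

/-- The operator `A ⊗ 1` applying `A` to the query register. -/
def onQuery {d : ℕ} (w : ℕ) (A : Matrix (Fin d) (Fin d) ℂ) :
    Matrix (Fin d × Fin w) (Fin d × Fin w) ℂ :=
  A ⊗ₖ (1 : Matrix (Fin w) (Fin w) ℂ)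

/-- The probability that the program with oracle `V`, started in the state `ρ`, outputs `1`. -/
def accept {d : ℕ} (V : U d) :
    {w : ℕ} → Program d w → Matrix (Fin d × Fin w) (Fin d × Fin w) ℂ → ℝ
  | _, output E _ _, ρ => (E * ρ).trace.re
  | w, query next, ρ =>
      next.accept V (onQuery w (V : Matrix (Fin d) (Fin d) ℂ) * ρ *
        (onQuery w (V : Matrix (Fin d) (Fin d) ℂ))ᴴ)
  | w, queryAdj next, ρ =>
      next.accept V (onQuery w ((V : Matrix (Fin d) (Fin d) ℂ)ᴴ) * ρ *
        (onQuery w ((V : Matrix (Fin d) (Fin d) ℂ)ᴴ))ᴴ)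
  | _, step _ K _ next, ρ => ∑ i, (next i).accept V (K i * ρ * (K i)ᴴ)

end Program

/-- A single-bit output adaptive quantum query algorithm: an initial density matrix and a
program. -/
structure Algorithm (d : ℕ) where
  memory : ℕ
  init : Matrix (Fin d × Fin memory) (Fin d × Fin memory) ℂ
  init_posSemidef : init.PosSemidef
  init_trace : init.trace = 1
  program : Program d memory

/-- `Pr[1 ← A^{V, V†} : V ∼ ν]`. -/
def Algorithm.acceptProb {d : ℕ} (A : Algorithm d) (ν : Measure (U d)) : ℝ :=
  ∫ V, A.program.accept V A.init ∂ν

/-- Adaptive mixed unitary `t`-designs: no adaptive algorithm that makes at most `t` queries in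
total to the unitary and its adjoint distinguishes `ν` from the Haar measure. -/
def IsAdaptiveMixedDesign {d : ℕ} (ν : Measure (U d)) (t : ℕ) : Prop :=
  ∀ A : Algorithm d, A.program.queries ≤ t → A.acceptProb ν = A.acceptProb (haarU d)

end UnitaryDesign

end

namespace UnitaryDesign

/-! A query to `V` conjugates the state by `V ⊗ 1`, so each new entry is a combination of old ones
times one entry of `V` and one conjugated entry. A query to `V†` does the same with the two roles
exchanged, so both kinds of query raise the bidegree by (1, 1). Oracle-independent operations are
linear with constant coefficients and leave it unchanged. Hence acceptance is the real part of an
element of `balancedPoly d t` (`Program.exists_accept_eq_re`), and the design property fixes the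
integrals of all of these (`IsDesign.integral_eq`). -/

/-- The span of the functions on `U(d)` that are monomials of degree `n` in the matrix entries and
of degree `n` in their complex conjugates. -/
def balancedPoly (d n : ℕ) : Submodule ℂ (U d → ℂ) :=
  Submodule.span ℂ {f | ∃ a b a' b' : Fin n → Fin d,
    f = fun V => (∏ k, V.1 (a k) (b k)) * star (∏ k, V.1 (a' k) (b' k))}

theorem entry_mul_mem_balancedPoly {d n : ℕ} {f : U d → ℂ} (hf : f ∈ balancedPoly d n)
    (i j i' j' : Fin d) :
    (fun V : U d => V.1 i j * f V * star (V.1 i' j')) ∈ balancedPoly d (n + 1) := by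
  induction hf using Submodule.span_induction with
  | mem f hf =>
    obtain ⟨a, b, a', b', rfl⟩ := hf
    refine Submodule.subset_span
      ⟨Fin.cons i a, Fin.cons j b, Fin.cons i' a', Fin.cons j' b', ?_⟩
    funext V
    simp only [Fin.prod_univ_succ, Fin.cons_zero, Fin.cons_succ, star_mul']
    ring
  | zero =>
    simp only [Pi.zero_apply, mul_zero, zero_mul]
    exact (balancedPoly d (n + 1)).zero_mem
  | add f g _ _ hf hg =>
    convert Submodule.add_mem _ hf hg using 1
    funext V
    simp only [Pi.add_apply]
    ring
  | smul c f _ hf =>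
    convert Submodule.smul_mem _ c hf using 1
    funext V
    simp only [Pi.smul_apply, smul_eq_mul]
    ring

theorem sum_entry_mul_star_entry {d : ℕ} (V : U d) (i : Fin d) :
    ∑ j, V.1 i j * star (V.1 i j) = 1 := by
  have h := congrFun (congrFun (Matrix.mem_unitaryGroup_iff.1 V.2) i) i
  simpa [Matrix.mul_apply] using h

/-- Multiply by 1 = ∑ j, |V 0 j|², the squared norm of a row; `NeZero d` provides row 0. This
absorbs branches with unused queries. -/
theorem balancedPoly_le_succ {d : ℕ} [NeZero d] (n : ℕ) :
    balancedPoly d n ≤ balancedPoly d (n + 1) := by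
  intro f hf
  have h := Submodule.sum_mem (balancedPoly d (n + 1)) (t := Finset.univ)
    fun j (_ : j ∈ Finset.univ) => entry_mul_mem_balancedPoly hf 0 j 0 j
  convert h using 1
  funext V
  rw [Finset.sum_apply]
  simp only [mul_right_comm _ (f V), ← Finset.sum_mul, sum_entry_mul_star_entry, one_mul]

theorem balancedPoly_mono {d : ℕ} [NeZero d] : Monotone (balancedPoly d) :=
  monotone_nat_of_le_succ balancedPoly_le_succ

theorem one_mem_balancedPoly_zero (d : ℕ) : (fun _ : U d => (1 : ℂ)) ∈ balancedPoly d 0 :=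
  Submodule.subset_span ⟨Fin.elim0, Fin.elim0, Fin.elim0, Fin.elim0, by simp⟩

theorem continuous_of_mem_balancedPoly {d n : ℕ} {f : U d → ℂ} (hf : f ∈ balancedPoly d n) :
    Continuous f := by
  induction hf using Submodule.span_induction with
  | mem f hf =>
    obtain ⟨a, b, a', b', rfl⟩ := hf
    have hentry (i j : Fin d) : Continuous fun V : U d => V.1 i j :=
      continuous_subtype_val.matrix_elem i j
    exact (continuous_finsetProd _ fun k _ => hentry _ _).mul
      (continuous_finsetProd _ fun k _ => hentry _ _).star
  | zero => exact continuous_const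
  | add f g _ _ hf hg => exact hf.add hg
  | smul c f _ hf => exact hf.const_smul c

theorem integrable_of_mem_balancedPoly {d n : ℕ} {f : U d → ℂ} (hf : f ∈ balancedPoly d n)
    (ν : Measure (U d)) [IsProbabilityMeasure ν] : Integrable f ν :=
  (continuous_of_mem_balancedPoly hf).integrable_of_hasCompactSupport
    (HasCompactSupport.of_compactSpace f)

theorem IsDesign.integral_eq {d t : ℕ} {ν : Measure (U d)} [IsProbabilityMeasure ν]
    (hν : IsDesign ν t) {f : U d → ℂ} (hf : f ∈ balancedPoly d t) :
    ∫ V, f V ∂ν = ∫ V, f V ∂(haarU d) := by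
  induction hf using Submodule.span_induction with
  | mem f hf =>
    obtain ⟨a, b, a', b', rfl⟩ := hf
    -- Testing the design on a matrix unit isolates one balanced monomial; `Fin.elim0` indexes the
    -- trivial factor for q = 0.
    have h := congrFun (congrFun
      (hν (Matrix.single (b, Fin.elim0) (b', Fin.elim0) 1)) (a, Fin.elim0)) (a', Fin.elim0)
    have key (V : U d) :
        (mixedPower t 0 V * (Matrix.single (b, Fin.elim0) (b', Fin.elim0) 1 :
          Matrix ((Fin t → Fin d) × (Fin 0 → Fin d)) ((Fin t → Fin d) × (Fin 0 → Fin d)) ℂ) *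
          (mixedPower t 0 V)ᴴ) (a, Fin.elim0) (a', Fin.elim0) =
        (∏ k, V.1 (a k) (b k)) * star (∏ k, V.1 (a' k) (b' k)) := by
      rw [Matrix.mul_apply, Finset.sum_eq_single (b', Fin.elim0)]
      · simp [mixedPower, tensorPower]
      · intro x _ hx
        rw [Matrix.mul_single_apply_of_ne (hbj := hx), zero_mul]
      · simp
    simpa only [matrixMean, Matrix.of_apply, key] using h
  | zero => simp
  | add f g hf hg ihf ihg =>
    simp only [Pi.add_apply]
    rw [integral_add (integrable_of_mem_balancedPoly hf _) (integrable_of_mem_balancedPoly hg _),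
      integral_add (integrable_of_mem_balancedPoly hf _) (integrable_of_mem_balancedPoly hg _),
      ihf, ihg]
  | smul c f _ ih =>
    simp only [Pi.smul_apply]
    rw [integral_smul, integral_smul, ih]

theorem conj_const_mem {α : Type} {S : Submodule ℂ (α → ℂ)} {m n : Type} [Fintype m]
    {ρ : α → Matrix m m ℂ} (hρ : ∀ x y, (fun V => ρ V x y) ∈ S) (A : Matrix n m ℂ)
    (B : Matrix m n ℂ) (x y : n) : (fun V => (A * ρ V * B) x y) ∈ S := by
  have h : (fun V => (A * ρ V * B) x y) =
      ∑ l, ∑ k, (A x k * B l y) • fun V => ρ V k l := by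
    funext V
    simp only [Matrix.mul_apply, Finset.sum_mul, Finset.sum_apply, Pi.smul_apply, smul_eq_mul]
    exact Finset.sum_congr rfl fun l _ => Finset.sum_congr rfl fun k _ => by ring
  rw [h]
  exact Submodule.sum_mem _ fun l _ => Submodule.sum_mem _ fun k _ =>
    Submodule.smul_mem _ _ (hρ k l)

theorem trace_const_mul_mem {α : Type} {S : Submodule ℂ (α → ℂ)} {m : Type} [Fintype m]
    {ρ : α → Matrix m m ℂ} (hρ : ∀ x y, (fun V => ρ V x y) ∈ S) (E : Matrix m m ℂ) :
    (fun V => (E * ρ V).trace) ∈ S := by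
  have h : (fun V => (E * ρ V).trace) = ∑ x, ∑ k, E x k • fun V => ρ V k x := by
    funext V
    simp [Matrix.trace, Matrix.mul_apply]
  rw [h]
  exact Submodule.sum_mem _ fun x _ => Submodule.sum_mem _ fun k _ =>
    Submodule.smul_mem _ _ (hρ k x)

theorem onQuery_conj_apply {d w : ℕ} (A : Matrix (Fin d) (Fin d) ℂ)
    (ρ : Matrix (Fin d × Fin w) (Fin d × Fin w) ℂ) (x y : Fin d × Fin w) :
    (Program.onQuery w A * ρ * (Program.onQuery w A)ᴴ) x y =
      ∑ j, ∑ i, A x.1 i * ρ (i, x.2) (j, y.2) * star (A y.1 j) := by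
  simp [Program.onQuery, Matrix.mul_apply, Fintype.sum_prod_type, Matrix.one_apply,
    Finset.sum_mul, apply_ite]

theorem onQuery_mem_balancedPoly {d w n : ℕ}
    {ρ : U d → Matrix (Fin d × Fin w) (Fin d × Fin w) ℂ}
    (hρ : ∀ x y, (fun V => ρ V x y) ∈ balancedPoly d n) (x y : Fin d × Fin w) :
    (fun V : U d => (Program.onQuery w V.1 * ρ V * (Program.onQuery w V.1)ᴴ) x y) ∈
      balancedPoly d (n + 1) := by
  have h := Submodule.sum_mem (balancedPoly d (n + 1)) (t := Finset.univ)
    fun j (_ : j ∈ Finset.univ) => Submodule.sum_mem _ (t := Finset.univ)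
      fun i (_ : i ∈ Finset.univ) =>
        entry_mul_mem_balancedPoly (hρ (i, x.2) (j, y.2)) x.1 i y.1 j
  convert h using 1
  funext V
  simp only [onQuery_conj_apply, Finset.sum_apply]

/-- Here the left factor supplies the conjugated entry and the right factor the plain one, hence the
swapped, transposed indices. -/
theorem onQuery_adjoint_mem_balancedPoly {d w n : ℕ}
    {ρ : U d → Matrix (Fin d × Fin w) (Fin d × Fin w) ℂ}
    (hρ : ∀ x y, (fun V => ρ V x y) ∈ balancedPoly d n) (x y : Fin d × Fin w) :
    (fun V : U d => (Program.onQuery w V.1ᴴ * ρ V * (Program.onQuery w V.1ᴴ)ᴴ) x y) ∈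
      balancedPoly d (n + 1) := by
  have h := Submodule.sum_mem (balancedPoly d (n + 1)) (t := Finset.univ)
    fun j (_ : j ∈ Finset.univ) => Submodule.sum_mem _ (t := Finset.univ)
      fun i (_ : i ∈ Finset.univ) =>
        entry_mul_mem_balancedPoly (hρ (i, x.2) (j, y.2)) j y.1 i x.1
  convert h using 1
  funext V
  simp only [onQuery_conj_apply, Finset.sum_apply, Matrix.conjTranspose_apply, star_star]
  exact Finset.sum_congr rfl fun j _ => Finset.sum_congr rfl fun i _ => by ring

/-- The acceptance probability of a program is the real part of a balanced polynomial in the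
oracle, whose degree is bounded by the number of queries. -/
theorem Program.exists_accept_eq_re {d t : ℕ} [NeZero d] {w : ℕ} (P : Program d w) (n : ℕ)
    (hn : n + P.queries ≤ t) (ρ : U d → Matrix (Fin d × Fin w) (Fin d × Fin w) ℂ)
    (hρ : ∀ x y, (fun V => ρ V x y) ∈ balancedPoly d n) :
    ∃ f ∈ balancedPoly d t, ∀ V, P.accept V (ρ V) = (f V).re := by
  -- Invariant: after `n` queries on a branch, the state has entries of degree `n` in the oracle.
  induction P generalizing n with
  | output E _ _ =>
    exact ⟨_, balancedPoly_mono (by simpa [queries] using hn) (trace_const_mul_mem hρ E),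
      fun V => rfl⟩
  | query next ih =>
    exact ih (n + 1) (by simp only [queries] at hn; omega) _ (onQuery_mem_balancedPoly hρ)
  | queryAdj next ih =>
    exact ih (n + 1) (by simp only [queries] at hn; omega) _ (onQuery_adjoint_mem_balancedPoly hρ)
  | step w' K hK next ih =>
    have hi (i) : n + (next i).queries ≤ t :=
      (Nat.add_le_add_left (Finset.le_sup (f := fun i => (next i).queries)
        (Finset.mem_univ i)) n).trans hn
    -- Branch states stay unnormalised, so no division by outcome probabilities spoils
    -- polynomiality.
    choose f hf hacc using fun i => ih i n (hi i) _ (conj_const_mem hρ (K i) (K i)ᴴ)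
    refine ⟨∑ i, f i, Submodule.sum_mem _ fun i _ => hf i, fun V => ?_⟩
    simp only [accept, hacc, Finset.sum_apply, Complex.re_sum]

theorem IsDesign.isAdaptiveMixedDesign {d t : ℕ} {ν : Measure (U d)} [IsProbabilityMeasure ν]
    (hν : IsDesign ν t) : IsAdaptiveMixedDesign ν t := by
  intro A hA
  rcases Nat.eq_zero_or_pos d with rfl | hd
  -- For d = 0 the trace is an empty sum, so no initial state of trace 1 exists.
  · simpa [Matrix.trace] using A.init_trace
  have : NeZero d := ⟨hd.ne'⟩
  obtain ⟨f, hf, hacc⟩ := A.program.exists_accept_eq_re 0 (by simpa using hA) (fun _ => A.init)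
    fun x y => by
      convert Submodule.smul_mem _ (A.init x y) (one_mem_balancedPoly_zero d) using 1
      funext V
      simp
  have hre (μ : Measure (U d)) [IsProbabilityMeasure μ] : A.acceptProb μ = (∫ V, f V ∂μ).re := by
    simp only [Algorithm.acceptProb, hacc]
    exact integral_re (integrable_of_mem_balancedPoly hf μ)
  rw [hre, hre, hν.integral_eq hf]

end UnitaryDesign

theorem mainTheorem8 (d t : ℕ) (ν : MeasureTheory.Measure (UnitaryDesign.U d))
    [MeasureTheory.IsProbabilityMeasure ν] (hν : UnitaryDesign.IsDesign ν t) :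
    UnitaryDesign.IsAdaptiveMixedDesign ν t :=
  hν.isAdaptiveMixedDesign
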